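/- Let $\mathfrak g$ be a three-dimensional real Lie algebra. A contact form on $\mathfrak g$ is a linear form $\alpha\in\mathfrak g^*$ with $\alpha\wedge d\alpha\neq 0$, where $d\alpha(v,w)=-\alpha([v,w])$. A contact structure on $\mathfrak g$ is a two-dimensional linear subspace $\Pi\subset\mathfrak g$ such that $[w,\Pi]\subset\Pi$ holds for no nonzero $w\in\Pi$. Two contact structures $\Pi_1,\Pi_2$ on $\mathfrak g$ are called isomorphic if $\varphi(\Pi_1)=\Pi_2$ for some Lie algebra automorphism $\varphi$ of $\mathfrak g$. Then $\mathfrak g$ admits a contact form, and likewise admits a contact structure, if and only if it is neither abelian nor isomorphic to the Lie algebra with basis $x,y,z$ and brackets $[x,z]=x$, $[y,z]=y$, $[x,y]=0$. If $\mathfrak g$ is not isomorphic to $\mathfrak{sl}(2,\mathbb R)$, then any two contact structures on $\mathfrak g$ are isomorphic. If $\mathfrak g$ is isomorphic to $\mathfrak{sl}(2,\mathbb R)$, then it has exactly two contact structures up to isomorphism. -/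

import Mathlib

namespace ContactLie

variable {L : Type*} [LieRing L] [LieAlgebra ℝ L]

/-- The Chevalley–Eilenberg differential of a linear form (trivial coefficients):
`(dα)(v, w) = -α([v, w])`. -/
def d (α : Module.Dual ℝ L) (v w : L) : ℝ := -α ⁅v, w⁆

/-- The `(2n+1)`-form `α ∧ (dα)ⁿ`, as a function of `2n+1` vectors, up to the
positive normalising constant of the wedge product. -/
def wedgePow (α : Module.Dual ℝ L) (n : ℕ) (v : Fin (2 * n + 1) → L) : ℝ :=
  ∑ σ : Equiv.Perm (Fin (2 * n + 1)), ((Equiv.Perm.sign σ : ℤ) : ℝ) *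
    (α (v (σ 0)) *
      ∏ i : Fin n, d α (v (σ ⟨2 * i + 1, by omega⟩)) (v (σ ⟨2 * i + 2, by omega⟩)))

/-- A contact form on a real Lie algebra of odd dimension `2n+1`: a linear form `α` with
`α ∧ (dα)ⁿ ≠ 0`. -/
def IsContactForm (α : Module.Dual ℝ L) : Prop :=
  ∃ n : ℕ, Module.finrank ℝ L = 2 * n + 1 ∧ ∃ v : Fin (2 * n + 1) → L, wedgePow α n v ≠ 0

/-- A contact structure on a real Lie algebra: a linear subspace `P` of codimension one such
that `ad w` maps `P` into `P` for no nonzero `w ∈ P`. -/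
def IsContactStructure (P : Submodule ℝ L) : Prop :=
  Module.finrank ℝ (L ⧸ P) = 1 ∧ ∀ w ∈ P, w ≠ 0 → ¬ ∀ v ∈ P, ⁅w, v⁆ ∈ P

/-- Two subspaces are isomorphic if an automorphism of the Lie algebra carries one onto the
other. -/
def Isomorphic (P Q : Submodule ℝ L) : Prop :=
  ∃ φ : L ≃ₗ⁅ℝ⁆ L, P.map (φ.toLinearEquiv : L →ₗ[ℝ] L) = Q

variable (L) in
/-- `L` is the three-dimensional Lie algebra with basis `x, y, z` and brackets `[x, z] = x`,
`[y, z] = y`, `[x, y] = 0`. -/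
def IsExceptional : Prop :=
  ∃ b : Module.Basis (Fin 3) ℝ L, ⁅b 0, b 2⁆ = b 0 ∧ ⁅b 1, b 2⁆ = b 1 ∧ ⁅b 0, b 1⁆ = 0

variable (L) in
/-- `L` is isomorphic to `sl(2, ℝ)`. -/
def IsSl2 : Prop :=
  Nonempty (L ≃ₗ⁅ℝ⁆ LieAlgebra.SpecialLinear.sl (Fin 2) ℝ)

end ContactLie

/-!
A plane `P` in `L` is a contact structure exactly when it is not a subalgebra, that is, when it has a
basis `u, v` for which `u, v, z = ⁅u, v⁆` is a basis of `L`; the coordinate form of `z` is then a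
contact form. Such a plane is missing only if every plane is a subalgebra. In that case
`⁅x, y⁆ = l y • x - l x • y` for a linear form `l`, so that `L` is abelian (`l = 0`) or the
exceptional algebra (`l ≠ 0`). Conversely, for such a bracket the three terms of `α ∧ dα` cancel for
every `α`.

For the classification, the remaining brackets `⁅w, z⁆` with `w ∈ P` are normalized by changes of
basis of `P`. Their `z`-component is the linear form `w ↦ tr (ad w)`. If it does not vanish on `P`,
then one may take `⁅u, z⁆ = 0` and `⁅v, z⁆ = -q u + z` with one parameter `q`, by the Jacobi
identity. If it vanishes, `w ↦ ⁅w, z⁆` is a traceless endomorphism of `P`, which amounts to the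
quadratic form `S` on `P` with `⁅w, ⁅w, z⁆⁆ = S(w) z`. Since `S` does not depend on the choice of
`u, v`, only its signature matters, and `⁅u, z⁆ = p v`, `⁅v, z⁆ = -q u` with `p, q ∈ {0, 1, -1}`
(`IsContactStructure.exists_isNormalBasis`).

Two planes with the same parameters are carried onto each other by an automorphism
(`IsNormalBasis.exists_lieEquiv`), so it remains to recover the parameters from `L`. The form
`tr (ad w)` tells the two families apart. In the first, the Killing form at a vector of trace `1`
gives `q`. In the second, the Killing form is `diag(2p, 2q, -2pq)`, whose signs determine `{p, q}`
except that `(1, 1)` and `(1, -1)` both give `sl(2, ℝ)`. These two planes are not isomorphic because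
the Killing form is definite on the one and indefinite on the other.
-/

namespace ContactLie

open Module Submodule

section

variable {L : Type*} [LieRing L] [LieAlgebra ℝ L]

/-- A basis whose first two vectors span `P` and whose third is the bracket of these two. A plane
in a three-dimensional Lie algebra is a contact structure exactly when it has such a basis. -/
structure IsContactBasis (P : Submodule ℝ L) (b : Basis (Fin 3) ℝ L) : Prop where
  span_eq : span ℝ {b 0, b 1} = P
  lie_eq : ⁅b 0, b 1⁆ = b 2

/-- A contact basis of `P` in which the remaining brackets are governed by `p`, `q`, `r`.

For `r = 0` this says that the quadratic form `S` with `⁅w, ⁅w, b 2⁆⁆ = S(w) • b 2` for `w ∈ P` is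
diagonal with entries `p` and `q`; hence the sign of `q` in the bracket. -/
structure IsNormalBasis (P : Submodule ℝ L) (p q r : ℝ) (b : Basis (Fin 3) ℝ L) : Prop
    extends IsContactBasis P b where
  lie_zero_two : ⁅b 0, b 2⁆ = p • b 1
  lie_one_two : ⁅b 1, b 2⁆ = -q • b 0 + r • b 2

/-! ### Contact bases -/

theorem basis_expand (b : Basis (Fin 3) ℝ L) (x : L) :
    x = b.repr x 0 • b 0 + b.repr x 1 • b 1 + b.repr x 2 • b 2 := by
  rw [← Fin.sum_univ_three fun i => b.repr x i • b i, b.sum_repr]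

theorem basis_coeff_eq (b : Basis (Fin 3) ℝ L) {x y z x' y' z' : ℝ}
    (h : x • b 0 + y • b 1 + z • b 2 = x' • b 0 + y' • b 1 + z' • b 2) :
    x = x' ∧ y = y' ∧ z = z' := by
  have h' : ∀ i, b.repr (x • b 0 + y • b 1 + z • b 2) i =
    b.repr (x' • b 0 + y' • b 1 + z' • b 2) i := fun i => by rw [h]
  refine ⟨by simpa using h' 0, by simpa using h' 1, by simpa using h' 2⟩

theorem exists_basis_of_notMem (hL : finrank ℝ L = 3) {P : Submodule ℝ L} {u v z : L}
    (huv : LinearIndependent ℝ ![u, v]) (hu : u ∈ P) (hv : v ∈ P) (hz : z ∉ P) :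
    ∃ b : Basis (Fin 3) ℝ L, b 0 = u ∧ b 1 = v ∧ b 2 = z := by
  have hli : LinearIndependent ℝ (Fin.snoc ![u, v] z : Fin 3 → L) := by
    refine huv.finSnoc fun hmem => hz ?_
    refine (span_le.2 ?_ : span ℝ (Set.range ![u, v]) ≤ P) hmem
    rintro _ ⟨i, rfl⟩
    fin_cases i
    exacts [hu, hv]
  refine ⟨basisOfLinearIndependentOfCardEqFinrank hli (by simp [hL]), ?_, ?_, ?_⟩ <;>
    rw [coe_basisOfLinearIndependentOfCardEqFinrank] <;> rfl

theorem linearIndependent_of_lie_notMem {u v : L} (h : ⁅u, v⁆ ∉ span ℝ {u, v}) :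
    LinearIndependent ℝ ![u, v] := by
  rw [LinearIndependent.pair_iff]
  intro s t hst
  by_contra hne
  apply h
  have h1 : t • ⁅u, v⁆ = 0 := by
    have := congrArg (fun x => ⁅u, x⁆) hst
    simpa using this
  have h2 : s • ⁅u, v⁆ = 0 := by
    have := congrArg (fun x => ⁅x, v⁆) hst
    simpa using this
  rcases smul_eq_zero.1 h1 with h1 | h1
  · rcases smul_eq_zero.1 h2 with h2 | h2
    · exact absurd ⟨h2, h1⟩ hne
    · simp [h2]
  · simp [h1]

/-- Two vectors whose bracket leaves their span extend, by that bracket, to a contact basis of the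
span. -/
theorem exists_isContactBasis (hL : finrank ℝ L = 3) {u v : L} (h : ⁅u, v⁆ ∉ span ℝ {u, v}) :
    ∃ b : Basis (Fin 3) ℝ L, IsContactBasis (span ℝ {u, v}) b ∧ b 0 = u ∧ b 1 = v := by
  obtain ⟨b, h0, h1, h2⟩ := exists_basis_of_notMem hL (linearIndependent_of_lie_notMem h)
    (subset_span (by simp)) (subset_span (by simp)) h
  exact ⟨b, ⟨by rw [h0, h1], by rw [h0, h1, h2]⟩, h0, h1⟩

theorem finrank_span_basis_pair (b : Basis (Fin 3) ℝ L) :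
    finrank ℝ (span ℝ {b 0, b 1}) = 2 := by
  have hli : LinearIndependent ℝ ![b 0, b 1] := by
    rw [LinearIndependent.pair_iff]
    intro s t h
    obtain ⟨h0, h1, -⟩ := basis_coeff_eq b (x := s) (y := t) (z := 0) (x' := 0) (y' := 0) (z' := 0)
      (by simpa using h)
    exact ⟨h0, h1⟩
  have hrange : Set.range ![b 0, b 1] = {b 0, b 1} := by
    rw [Matrix.range_cons, Matrix.range_cons, Matrix.range_empty, Set.union_empty]
    rfl
  rw [← hrange, finrank_span_eq_card hli, Fintype.card_fin]

theorem mem_span_basis_pair_iff (b : Basis (Fin 3) ℝ L) {x : L} :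
    x ∈ span ℝ {b 0, b 1} ↔ b.repr x 2 = 0 := by
  rw [mem_span_pair]
  constructor
  · rintro ⟨s, t, rfl⟩
    simp
  · intro h
    refine ⟨b.repr x 0, b.repr x 1, ?_⟩
    conv_rhs => rw [basis_expand b x, h]
    simp

theorem IsContactBasis.isContactStructure {P : Submodule ℝ L} {b : Basis (Fin 3) ℝ L}
    (h : IsContactBasis P b) : IsContactStructure P := by
  have : FiniteDimensional ℝ L := b.finiteDimensional_of_finite
  obtain ⟨rfl, h2⟩ := h
  constructor
  · have := (span ℝ {b 0, b 1}).finrank_quotient_add_finrank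
    rw [finrank_span_basis_pair, finrank_eq_card_basis b] at this
    simpa using this
  · intro w hw hw0 hinv
    obtain ⟨s, t, rfl⟩ := mem_span_pair.1 hw
    have h0 := hinv (b 0) (subset_span (by simp))
    have h1 := hinv (b 1) (subset_span (by simp))
    rw [mem_span_basis_pair_iff, add_lie, smul_lie, smul_lie, ← lie_skew (b 1) (b 0), h2] at h0
    rw [mem_span_basis_pair_iff, add_lie, smul_lie, smul_lie, h2] at h1
    apply hw0
    have ht : t = 0 := by simpa using h0
    have hs : s = 0 := by simpa using h1
    simp [hs, ht]

theorem IsContactStructure.exists_isContactBasis (hL : finrank ℝ L = 3) {P : Submodule ℝ L}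
    (hP : IsContactStructure P) : ∃ b : Basis (Fin 3) ℝ L, IsContactBasis P b := by
  have : FiniteDimensional ℝ L := .of_finrank_pos (by omega)
  obtain ⟨h1, h2⟩ := hP
  have hP2 : finrank ℝ P = 2 := by
    have := P.finrank_quotient_add_finrank
    omega
  let e := finBasisOfFinrankEq ℝ P hP2
  have hspan : span ℝ {(e 0 : L), (e 1 : L)} = P := by
    have h := congrArg (Submodule.map P.subtype) e.span_eq
    rw [Submodule.map_span, Submodule.map_top, range_subtype, ← Set.range_comp] at h
    refine Eq.trans ?_ h
    congr 1
    ext x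
    simp [Fin.exists_fin_two, eq_comm]
  have hnot : ⁅(e 0 : L), (e 1 : L)⁆ ∉ P := by
    intro hmem
    refine h2 (e 0) (e 0).2 (by simpa using e.ne_zero 0) fun v hv => ?_
    rw [← hspan] at hv
    obtain ⟨s, t, rfl⟩ := mem_span_pair.1 hv
    simpa using P.smul_mem t hmem
  obtain ⟨b, hb, -⟩ := ContactLie.exists_isContactBasis hL (u := (e 0 : L)) (v := (e 1 : L))
    (by rwa [hspan])
  exact ⟨b, hspan ▸ hb⟩

/-! ### Normal forms -/

/-- A linear change of basis of `P` induces a new contact basis, whose third vector is the old one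
scaled by the determinant. -/
theorem IsContactBasis.exists_change {P : Submodule ℝ L} {b : Basis (Fin 3) ℝ L}
    (h : IsContactBasis P b) {s t s' t' : ℝ} (hdet : s * t' - t * s' ≠ 0) :
    ∃ c : Basis (Fin 3) ℝ L, IsContactBasis P c ∧ c 0 = s • b 0 + t • b 1 ∧
      c 1 = s' • b 0 + t' • b 1 ∧ c 2 = (s * t' - t * s') • b 2 := by
  have hL : finrank ℝ L = 3 := by simpa using finrank_eq_card_basis b
  have : FiniteDimensional ℝ L := b.finiteDimensional_of_finite
  have hlie : ⁅s • b 0 + t • b 1, s' • b 0 + t' • b 1⁆ = (s * t' - t * s') • b 2 := by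
    simp only [add_lie, lie_add, smul_lie, lie_smul, lie_self, ← lie_skew (b 1) (b 0), h.lie_eq]
    module
  have hle : span ℝ {s • b 0 + t • b 1, s' • b 0 + t' • b 1} ≤ span ℝ {b 0, b 1} := by
    rw [span_le, Set.pair_subset_iff]
    exact ⟨mem_span_pair.2 ⟨s, t, rfl⟩, mem_span_pair.2 ⟨s', t', rfl⟩⟩
  obtain ⟨c, hc, h0, h1⟩ := exists_isContactBasis hL
      (u := s • b 0 + t • b 1) (v := s' • b 0 + t' • b 1) fun hmem => by
    have := hle hmem
    rw [hlie, mem_span_basis_pair_iff] at this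
    exact hdet (by simpa using this)
  refine ⟨c, ⟨?_, hc.lie_eq⟩, h0, h1, by rw [← hc.lie_eq, h0, h1, hlie]⟩
  rw [← h.span_eq]
  refine eq_of_le_of_finrank_eq (by rw [h0, h1]; exact hle) ?_
  rw [finrank_span_basis_pair, finrank_span_basis_pair]

/-- The Jacobi identity for the three vectors of a contact basis, in coordinates. -/
theorem IsContactBasis.jacobi {P : Submodule ℝ L} {b : Basis (Fin 3) ℝ L}
    (h : IsContactBasis P b) {a₀ a₁ a₂ c₀ c₁ c₂ : ℝ}
    (h02 : ⁅b 0, b 2⁆ = a₀ • b 0 + a₁ • b 1 + a₂ • b 2)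
    (h12 : ⁅b 1, b 2⁆ = c₀ • b 0 + c₁ • b 1 + c₂ • b 2) :
    c₁ = -a₀ ∧ c₂ * a₀ = a₂ * c₀ ∧ c₂ * a₁ = a₂ * c₁ := by
  have hJ := leibniz_lie (b 0) (b 1) (b 2)
  rw [h.lie_eq, lie_self, zero_add, h02, h12] at hJ
  simp only [lie_add, lie_smul, lie_self, ← lie_skew (b 1) (b 0), h.lie_eq, h02, h12] at hJ
  obtain ⟨h0, h1, h2⟩ := basis_coeff_eq b (x := c₂ * a₀) (y := c₂ * a₁) (z := c₁ + c₂ * a₂)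
    (x' := a₂ * c₀) (y' := a₂ * c₁) (z' := -a₀ + a₂ * c₂)
    ((Eq.trans (by module) hJ).trans (by module))
  exact ⟨by linarith, h0, h1⟩

/-- In the nonunimodular case, take the new first vector in the kernel of the form
`w ↦ tr (ad w)` on `P`, whose values on `b 0` and `b 1` are `a₂` and `c₂`, and the second one
with trace `1`. The Jacobi identity does the rest. -/
theorem IsContactBasis.exists_normal_of_ne {P : Submodule ℝ L} {b : Basis (Fin 3) ℝ L}
    (h : IsContactBasis P b) {a₀ a₁ a₂ c₀ c₁ c₂ : ℝ}
    (h02 : ⁅b 0, b 2⁆ = a₀ • b 0 + a₁ • b 1 + a₂ • b 2)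
    (h12 : ⁅b 1, b 2⁆ = c₀ • b 0 + c₁ • b 1 + c₂ • b 2) (hne : a₂ ≠ 0 ∨ c₂ ≠ 0) :
    ∃ q c, IsNormalBasis P 0 q 1 c := by
  obtain ⟨-, hJ1, hJ2⟩ := h.jacobi h02 h12
  set D := a₂ ^ 2 + c₂ ^ 2 with hD
  have hD0 : D ≠ 0 := by
    rcases hne with h | h <;> positivity
  have hdet : c₂ * (c₂ / D) - -a₂ * (a₂ / D) = 1 := by
    field_simp
    rw [hD]; ring
  obtain ⟨c, hc, h0, h1, h2⟩ := h.exists_change (s := c₂) (t := -a₂) (s' := a₂ / D)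
    (t' := c₂ / D) (by rw [hdet]; exact one_ne_zero)
  rw [hdet, one_smul] at h2
  have hc02 : ⁅c 0, c 2⁆ = 0 := by
    rw [h0, h2, add_lie, smul_lie, smul_lie, h02, h12]
    trans (c₂ * a₀ - a₂ * c₀) • b 0 + (c₂ * a₁ - a₂ * c₁) • b 1
    · module
    · simp [hJ1, hJ2]
  have hr : c.repr ⁅c 1, c 2⁆ 2 = 1 := by
    have hspan : ∀ x ∈ P, c.repr x 2 = 0 := fun x hx =>
      (mem_span_basis_pair_iff c).1 (hc.span_eq ▸ hx)
    have : ⁅c 1, c 2⁆ = ((a₂ / D * a₀ + c₂ / D * c₀) • b 0 + (a₂ / D * a₁ + c₂ / D * c₁) • b 1)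
        + c 2 := by
      have h1' : a₂ / D * a₂ + c₂ / D * c₂ = 1 := by linarith
      rw [h1, h2, add_lie, smul_lie, smul_lie, h02, h12]
      trans ((a₂ / D * a₀ + c₂ / D * c₀) • b 0 + (a₂ / D * a₁ + c₂ / D * c₁) • b 1)
        + (a₂ / D * a₂ + c₂ / D * c₂) • b 2
      · module
      · rw [h1', one_smul]
    rw [this, map_add, Finsupp.add_apply, hspan]
    · simp
    · rw [← h.span_eq]
      exact mem_span_pair.2 ⟨_, _, rfl⟩
  obtain ⟨hK, -, -⟩ := hc.jacobi (a₀ := 0) (a₁ := 0) (a₂ := 0) (by simpa using hc02)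
    (basis_expand c ⁅c 1, c 2⁆)
  refine ⟨-c.repr ⁅c 1, c 2⁆ 0, c, hc, by simpa using hc02, ?_⟩
  conv_lhs => rw [basis_expand c ⁅c 1, c 2⁆, hr, hK]
  simp

/-- In the unimodular case, the quadratic form `S` on `P` with `⁅w, ⁅w, b 2⁆⁆ = S(w) • b 2` can be
diagonalized. Its matrix in `b 0`, `b 1` has diagonal entries `d`, `-e` and off-diagonal entry `-a`;
complete the square, or use the sum and the difference of the basis vectors if `d = e = 0`. -/
theorem IsContactBasis.exists_diagonal {P : Submodule ℝ L} {b : Basis (Fin 3) ℝ L}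
    (h : IsContactBasis P b) {a d e : ℝ} (h02 : ⁅b 0, b 2⁆ = a • b 0 + d • b 1)
    (h12 : ⁅b 1, b 2⁆ = e • b 0 - a • b 1) :
    ∃ p q c, IsNormalBasis P p q 0 c := by
  by_cases hd : d = 0
  · by_cases he : e = 0
    · obtain ⟨c, hc, h0, h1, h2⟩ := h.exists_change (s := 1) (t := 1) (s' := -1 / 2)
        (t' := 1 / 2) (by norm_num)
      refine ⟨-2 * a, a / 2, c, hc, ?_, ?_⟩
      all_goals
        simp only [h0, h1, h2, add_lie, smul_lie, lie_smul, h02, h12, hd, he]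
        module
    · obtain ⟨c, hc, h0, h1, h2⟩ := h.exists_change (s := 1) (t := -(a / e)) (s' := 0)
        (t' := 1) (by norm_num)
      refine ⟨d + a ^ 2 / e, -e, c, hc, ?_, ?_⟩
      all_goals
        simp only [h0, h1, h2, add_lie, smul_lie, lie_smul, h02, h12]
        match_scalars <;> field_simp <;> ring
  · obtain ⟨c, hc, h0, h1, h2⟩ := h.exists_change (s := 1) (t := 0) (s' := a / d)
      (t' := 1) (by norm_num)
    refine ⟨d, -(e + a ^ 2 / d), c, hc, ?_, ?_⟩
    all_goals
      simp only [h0, h1, h2, add_lie, smul_lie, lie_smul, h02, h12]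
      match_scalars <;> field_simp <;> ring

theorem IsNormalBasis.exists_rescale {P : Submodule ℝ L} {p q : ℝ} {b : Basis (Fin 3) ℝ L}
    (h : IsNormalBasis P p q 0 b) {s t : ℝ} (hs : s ≠ 0) (ht : t ≠ 0) :
    ∃ c, IsNormalBasis P (s ^ 2 * p) (t ^ 2 * q) 0 c := by
  obtain ⟨c, hc, h0, h1, h2⟩ := h.exists_change (s := s) (t := 0) (s' := 0) (t' := t)
    (by simp [hs, ht])
  refine ⟨c, hc, ?_, ?_⟩
  all_goals
    simp only [h0, h1, h2, add_lie, smul_lie, lie_smul, h.lie_zero_two, h.lie_one_two]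
    module

theorem IsNormalBasis.exists_swap {P : Submodule ℝ L} {p q : ℝ} {b : Basis (Fin 3) ℝ L}
    (h : IsNormalBasis P p q 0 b) : ∃ c, IsNormalBasis P q p 0 c := by
  obtain ⟨c, hc, h0, h1, h2⟩ := h.exists_change (s := 0) (t := 1) (s' := -1) (t' := 0)
    (by norm_num)
  refine ⟨c, hc, ?_, ?_⟩
  all_goals
    simp only [h0, h1, h2, add_lie, smul_lie, lie_smul, h.lie_zero_two, h.lie_one_two]
    module

theorem exists_sq_mul_eq (x : ℝ) :
    ∃ s : ℝ, s ≠ 0 ∧ (s ^ 2 * x = -1 ∨ s ^ 2 * x = 0 ∨ s ^ 2 * x = 1) := by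
  rcases eq_or_ne x 0 with rfl | hx
  · exact ⟨1, one_ne_zero, by simp⟩
  · have hpos : 0 < |x| := abs_pos.2 hx
    refine ⟨(√|x|)⁻¹, inv_ne_zero (Real.sqrt_ne_zero'.2 hpos), ?_⟩
    rw [inv_pow, Real.sq_sqrt hpos.le]
    rcases abs_choice x with h | h <;> rw [h]
    · simp [hx]
    · simp [hx, inv_neg]

/-- The possible signatures of the quadratic form on `P` in the unimodular case, with its diagonal
entries normalized to `0`, `1`, `-1` and listed so that `q ≤ p`. The pairs belong in turn to the
Heisenberg algebra, the Lie algebras of the isometry groups of the Minkowski and the Euclidean plane,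
`su(2)`, and twice to `sl(2, ℝ)`. -/
def IsNormalPair (p q : ℝ) : Prop :=
  p = 0 ∧ q = 0 ∨ p = 1 ∧ q = 0 ∨ p = 0 ∧ q = -1 ∨ p = -1 ∧ q = -1 ∨ p = 1 ∧ q = 1 ∨
    p = 1 ∧ q = -1

theorem IsContactStructure.exists_isNormalBasis (hL : finrank ℝ L = 3) {P : Submodule ℝ L}
    (hP : IsContactStructure P) : (∃ q b, IsNormalBasis P 0 q 1 b) ∨
      ∃ p q b, IsNormalPair p q ∧ IsNormalBasis P p q 0 b := by
  obtain ⟨b, hb⟩ := hP.exists_isContactBasis hL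
  have h02 := basis_expand b ⁅b 0, b 2⁆
  have h12 := basis_expand b ⁅b 1, b 2⁆
  by_cases hne : b.repr ⁅b 0, b 2⁆ 2 ≠ 0 ∨ b.repr ⁅b 1, b 2⁆ 2 ≠ 0
  · exact .inl (hb.exists_normal_of_ne h02 h12 hne)
  · right
    push Not at hne
    obtain ⟨hJ, -, -⟩ := hb.jacobi h02 h12
    rw [hne.1, zero_smul, add_zero] at h02
    rw [hne.2, zero_smul, add_zero, hJ, neg_smul, ← sub_eq_add_neg] at h12
    obtain ⟨p, q, c, hc⟩ := hb.exists_diagonal h02 h12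
    obtain ⟨s, hs, hs'⟩ := exists_sq_mul_eq p
    obtain ⟨t, ht, ht'⟩ := exists_sq_mul_eq q
    obtain ⟨e, he⟩ := hc.exists_rescale hs ht
    obtain ⟨e', he'⟩ := he.exists_swap
    -- The swapped basis serves where `p < q`.
    rcases hs' with hp | hp | hp <;> rcases ht' with hq | hq | hq <;> rw [hp, hq] at he he'
    · exact ⟨_, _, e, by norm_num [IsNormalPair], he⟩
    · exact ⟨_, _, e', by norm_num [IsNormalPair], he'⟩
    · exact ⟨_, _, e', by norm_num [IsNormalPair], he'⟩
    · exact ⟨_, _, e, by norm_num [IsNormalPair], he⟩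
    · exact ⟨_, _, e, by norm_num [IsNormalPair], he⟩
    · exact ⟨_, _, e', by norm_num [IsNormalPair], he'⟩
    · exact ⟨_, _, e, by norm_num [IsNormalPair], he⟩
    · exact ⟨_, _, e, by norm_num [IsNormalPair], he⟩
    · exact ⟨_, _, e, by norm_num [IsNormalPair], he⟩

/-! ### Traces of adjoint maps in a normal basis -/

theorem IsNormalBasis.toMatrix_ad {P : Submodule ℝ L} {p q r : ℝ} {b : Basis (Fin 3) ℝ L}
    (h : IsNormalBasis P p q r b) (w : L) :
    LinearMap.toMatrix b b (LieAlgebra.ad ℝ L w) =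
      !![0, b.repr w 2 * q, -(b.repr w 1 * q);
        -(b.repr w 2 * p), 0, b.repr w 0 * p;
        -b.repr w 1, b.repr w 0 - b.repr w 2 * r, b.repr w 1 * r] := by
  have hw : ∀ j, ⁅w, b j⁆ = b.repr w 0 • ⁅b 0, b j⁆ + b.repr w 1 • ⁅b 1, b j⁆
      + b.repr w 2 • ⁅b 2, b j⁆ := fun j => by
    conv_lhs => rw [basis_expand b w]
    simp only [add_lie, smul_lie]
  ext i j
  rw [LinearMap.toMatrix_apply, LieAlgebra.ad_apply, hw]
  fin_cases j <;>
    simp only [Fin.zero_eta, Fin.mk_one, Fin.reduceFinMk, lie_self, ← lie_skew (b 1) (b 0),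
      ← lie_skew (b 2) (b 0), ← lie_skew (b 2) (b 1), h.lie_eq, h.lie_zero_two, h.lie_one_two] <;>
    (fin_cases i <;> simp <;> ring)

theorem IsNormalBasis.trace_ad {P : Submodule ℝ L} {p q r : ℝ} {b : Basis (Fin 3) ℝ L}
    (h : IsNormalBasis P p q r b) (w : L) :
    LinearMap.trace ℝ L (LieAlgebra.ad ℝ L w) = r * b.repr w 1 := by
  rw [LinearMap.trace_eq_matrix_trace ℝ b, h.toMatrix_ad, Matrix.trace_fin_three]
  simp [mul_comm]

theorem IsNormalBasis.killingForm_self {P : Submodule ℝ L} {p q r : ℝ} {b : Basis (Fin 3) ℝ L}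
    (h : IsNormalBasis P p q r b) (w : L) :
    killingForm ℝ L w w = 2 * p * b.repr w 0 * (b.repr w 0 - r * b.repr w 2)
      + (2 * q + r ^ 2) * b.repr w 1 ^ 2 - 2 * p * q * b.repr w 2 ^ 2 := by
  rw [killingForm_apply_apply, LinearMap.trace_eq_matrix_trace ℝ b, LinearMap.toMatrix_comp b b b,
    h.toMatrix_ad, Matrix.trace_fin_three]
  simp [Matrix.mul_apply, Fin.sum_univ_three]
  ring

/-! ### Transport along isomorphisms -/

theorem IsNormalBasis.map {L' : Type*} [LieRing L'] [LieAlgebra ℝ L'] {P : Submodule ℝ L}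
    {p q r : ℝ} {b : Basis (Fin 3) ℝ L} (h : IsNormalBasis P p q r b) (φ : L ≃ₗ⁅ℝ⁆ L') :
    IsNormalBasis (P.map (φ.toLinearEquiv : L →ₗ[ℝ] L')) p q r (b.map φ.toLinearEquiv) where
  span_eq := by
    rw [← h.span_eq, Submodule.map_span, Set.image_pair]
    simp
  lie_eq := by simpa [LieEquiv.map_lie] using congrArg φ h.lie_eq
  lie_zero_two := by simpa [LieEquiv.map_lie] using congrArg φ h.lie_zero_two
  lie_one_two := by simpa [LieEquiv.map_lie] using congrArg φ h.lie_one_two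

/-- Equal structure constants give an isomorphism that carries the one plane onto the other. -/
theorem IsNormalBasis.exists_lieEquiv {L' : Type*} [LieRing L'] [LieAlgebra ℝ L']
    {P : Submodule ℝ L} {P' : Submodule ℝ L'} {p q r : ℝ} {b : Basis (Fin 3) ℝ L}
    {b' : Basis (Fin 3) ℝ L'} (h : IsNormalBasis P p q r b) (h' : IsNormalBasis P' p q r b') :
    ∃ φ : L ≃ₗ⁅ℝ⁆ L', P.map (φ.toLinearEquiv : L →ₗ[ℝ] L') = P' := by
  let e : L ≃ₗ[ℝ] L' := b.equiv b' (Equiv.refl _)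
  have he : ∀ i, e (b i) = b' i := fun i => by simp [e]
  have hlie : ∀ x y, e ⁅x, y⁆ = ⁅e x, e y⁆ := by
    intro x y
    rw [basis_expand b x, basis_expand b y]
    simp only [add_lie, lie_add, smul_lie, lie_smul, lie_self, ← lie_skew (b 1) (b 0),
      ← lie_skew (b 2) (b 0), ← lie_skew (b 2) (b 1), ← lie_skew (b' 1) (b' 0),
      ← lie_skew (b' 2) (b' 0), ← lie_skew (b' 2) (b' 1), h.lie_eq, h.lie_zero_two, h.lie_one_two,
      h'.lie_eq, h'.lie_zero_two, h'.lie_one_two, map_add, map_smul, map_neg, map_zero, he]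
  let φ : L ≃ₗ⁅ℝ⁆ L' := { e with map_lie' := hlie _ _ }
  refine ⟨φ, ?_⟩
  rw [← h.span_eq, ← h'.span_eq, Submodule.map_span, Set.image_pair]
  change span ℝ {e (b 0), e (b 1)} = _
  rw [he, he]

/-! ### Recovering the normal form from the Lie algebra -/

theorem IsNormalBasis.not_unimodular {P Q : Submodule ℝ L} {p q p' q' : ℝ}
    {b c : Basis (Fin 3) ℝ L} (hb : IsNormalBasis P p q 1 b) (hc : IsNormalBasis Q p' q' 0 c) :
    False := by
  have := (hb.trace_ad (b 1)).symm.trans (hc.trace_ad (b 1))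
  simp at this

theorem IsNormalBasis.eq_of_nonunimodular {P Q : Submodule ℝ L} {q q' : ℝ}
    {b c : Basis (Fin 3) ℝ L} (hb : IsNormalBasis P 0 q 1 b) (hc : IsNormalBasis Q 0 q' 1 c) :
    q = q' := by
  have h1 := (hb.trace_ad (b 1)).symm.trans (hc.trace_ad (b 1))
  have h2 := (hb.killingForm_self (b 1)).symm.trans (hc.killingForm_self (b 1))
  simp only [Basis.repr_self, Finsupp.single_eq_same, one_mul] at h1 h2
  rw [← h1] at h2
  linarith

theorem IsNormalBasis.killingForm_self_of_unimodular {P : Submodule ℝ L} {p q : ℝ}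
    {b : Basis (Fin 3) ℝ L} (h : IsNormalBasis P p q 0 b) (w : L) :
    killingForm ℝ L w w =
      2 * (p * b.repr w 0 ^ 2 + q * b.repr w 1 ^ 2 - p * q * b.repr w 2 ^ 2) := by
  rw [h.killingForm_self]; ring

/-- In the unimodular case the Killing form is `2 (p x² + q y² - p q z²)`. Which signs it takes
determines `(p, q)`, apart from the two pairs of `sl(2, ℝ)`. -/
theorem IsNormalBasis.exists_killingForm_pos_iff {P : Submodule ℝ L} {p q : ℝ}
    {b : Basis (Fin 3) ℝ L} (h : IsNormalPair p q) (hb : IsNormalBasis P p q 0 b) :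
    (∃ w, 0 < killingForm ℝ L w w) ↔ p = 1 := by
  constructor
  · rintro ⟨w, hw⟩
    rw [hb.killingForm_self_of_unimodular] at hw
    by_contra hp
    rcases h with h | h | h | h | h | h <;> obtain ⟨rfl, rfl⟩ := h <;>
      first
      | exact hp rfl
      | nlinarith [sq_nonneg (b.repr w 0), sq_nonneg (b.repr w 1), sq_nonneg (b.repr w 2)]
  · rintro rfl
    exact ⟨b 0, by simp [hb.killingForm_self_of_unimodular]⟩

theorem IsNormalBasis.exists_killingForm_neg_iff {P : Submodule ℝ L} {p q : ℝ}
    {b : Basis (Fin 3) ℝ L} (h : IsNormalPair p q) (hb : IsNormalBasis P p q 0 b) :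
    (∃ w, killingForm ℝ L w w < 0) ↔ q ≠ 0 := by
  constructor
  · rintro ⟨w, hw⟩ rfl
    rw [hb.killingForm_self_of_unimodular] at hw
    rcases h with h | h | h | h | h | h <;> obtain ⟨rfl, h⟩ := h <;>
      nlinarith [sq_nonneg (b.repr w 0)]
  · intro hq
    rcases h with h | h | h | h | h | h <;> obtain ⟨rfl, rfl⟩ := h
    · exact absurd rfl hq
    · exact absurd rfl hq
    · exact ⟨b 1, by simp [hb.killingForm_self_of_unimodular]⟩
    · exact ⟨b 1, by simp [hb.killingForm_self_of_unimodular]⟩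
    · exact ⟨b 2, by simp [hb.killingForm_self_of_unimodular]⟩
    · exact ⟨b 1, by simp [hb.killingForm_self_of_unimodular]⟩

theorem IsNormalBasis.killingForm_neg_definite_iff {P : Submodule ℝ L} {p q : ℝ}
    {b : Basis (Fin 3) ℝ L} (h : IsNormalPair p q) (hb : IsNormalBasis P p q 0 b) :
    (∀ w ≠ 0, killingForm ℝ L w w < 0) ↔ p = -1 := by
  constructor
  · intro hneg
    have h0 := hneg (b 0) (b.ne_zero 0)
    rw [hb.killingForm_self_of_unimodular] at h0
    have h02 : b.repr (b 0) 2 = 0 := by simp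
    have h01 : b.repr (b 0) 1 = 0 := by simp
    rw [h02, h01, Basis.repr_self, Finsupp.single_eq_same] at h0
    rcases h with h | h | h | h | h | h <;> obtain ⟨rfl, rfl⟩ := h <;>
      first
      | rfl
      | (norm_num at h0)
  · rintro rfl w hw
    obtain rfl : q = -1 := by
      unfold IsNormalPair at h
      norm_num at h
      exact h
    rw [hb.killingForm_self_of_unimodular]
    by_contra! hle
    have h0 : b.repr w 0 = 0 := by nlinarith [sq_nonneg (b.repr w 1), sq_nonneg (b.repr w 2)]
    have h1 : b.repr w 1 = 0 := by nlinarith [sq_nonneg (b.repr w 0), sq_nonneg (b.repr w 2)]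
    have h2 : b.repr w 2 = 0 := by nlinarith [sq_nonneg (b.repr w 0), sq_nonneg (b.repr w 1)]
    apply hw
    rw [basis_expand b w, h0, h1, h2]
    simp

/-- Exchanging the last two vectors of the basis turns one contact structure of `sl(2, ℝ)` into
the other. -/
theorem IsNormalBasis.swap_last {P : Submodule ℝ L} {b : Basis (Fin 3) ℝ L} {q : ℝ}
    (hb : IsNormalBasis P 1 q 0 b) :
    ∃ (Q : Submodule ℝ L) (c : Basis (Fin 3) ℝ L), IsNormalBasis Q 1 (-q) 0 c := by
  refine ⟨_, b.reindex (Equiv.swap 1 2), ⟨rfl, ?_⟩, ?_, ?_⟩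
  all_goals
    simp only [Basis.reindex_apply, Equiv.symm_swap, Equiv.swap_apply_left,
      Equiv.swap_apply_right, Equiv.swap_apply_of_ne_of_ne (show (0 : Fin 3) ≠ 1 by decide)
        (show (0 : Fin 3) ≠ 2 by decide)]
  · simpa using hb.lie_zero_two
  · simpa using hb.lie_eq
  · rw [← lie_skew (b 2) (b 1), hb.lie_one_two]
    simp

/-! ### The Lie algebra `sl(2, ℝ)` -/

/-- Coordinates on `sl(2, ℝ)` in the basis `h / 2`, `(e + f) / 2`, `(e - f) / 2`, where `h, e, f`
is the standard triple. The halves make this basis normal with parameters `1, 1, 0`. -/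
noncomputable def sl2EquivFun : LieAlgebra.SpecialLinear.sl (Fin 2) ℝ ≃ₗ[ℝ] (Fin 3 → ℝ) where
  toFun M := ![2 * M.1 0 0, M.1 0 1 + M.1 1 0, M.1 0 1 - M.1 1 0]
  invFun x := ⟨!![x 0 / 2, (x 1 + x 2) / 2; (x 1 - x 2) / 2, -(x 0 / 2)], by
    change Matrix.trace (!![x 0 / 2, (x 1 + x 2) / 2; (x 1 - x 2) / 2, -(x 0 / 2)] :
      Matrix (Fin 2) (Fin 2) ℝ) = 0
    simp [Matrix.trace_fin_two]⟩
  map_add' M N := by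
    ext i
    fin_cases i <;> simp <;> ring
  map_smul' c M := by
    ext i
    fin_cases i <;> simp <;> ring
  left_inv M := by
    have hM : M.1 0 0 + M.1 1 1 = 0 := by
      have htr : Matrix.trace M.1 = 0 := M.2
      rwa [Matrix.trace_fin_two] at htr
    ext i j
    fin_cases i <;> fin_cases j <;> simp <;> linarith
  right_inv x := by
    ext i
    fin_cases i <;> simp <;> ring

theorem exists_isNormalBasis_sl2 :
    ∃ P b, IsNormalBasis (L := LieAlgebra.SpecialLinear.sl (Fin 2) ℝ) P 1 1 0 b := by
  refine ⟨_, Basis.ofEquivFun sl2EquivFun, ⟨rfl, ?_⟩, ?_, ?_⟩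
  all_goals
    apply Subtype.ext
    rw [LieAlgebra.SpecialLinear.sl_bracket]
    simp only [Basis.coe_ofEquivFun]
    ext i j
    fin_cases i <;> fin_cases j <;>
      (simp [sl2EquivFun]; try norm_num)

theorem isSl2_iff : IsSl2 L ↔ ∃ (P : Submodule ℝ L) (b : _), IsNormalBasis P 1 1 0 b := by
  obtain ⟨P, b, hb⟩ := exists_isNormalBasis_sl2
  constructor
  · rintro ⟨φ⟩
    exact ⟨_, _, hb.map φ.symm⟩
  · rintro ⟨Q, c, hc⟩
    obtain ⟨φ, -⟩ := hc.exists_lieEquiv hb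
    exact ⟨φ⟩

/-! ### Classification of contact structures -/

theorem isomorphic_of_not_isSl2 (hL : finrank ℝ L = 3) (hsl : ¬ IsSl2 L) {P Q : Submodule ℝ L}
    (hP : IsContactStructure P) (hQ : IsContactStructure Q) : Isomorphic P Q := by
  have hnot : ∀ {R : Submodule ℝ L} {q : ℝ} {b}, IsNormalBasis R 1 q 0 b → q ≠ 1 ∧ q ≠ -1 := by
    intro R q b hb
    refine ⟨?_, ?_⟩ <;> rintro rfl
    · exact hsl (isSl2_iff.2 ⟨_, _, hb⟩)
    · obtain ⟨_, _, hc⟩ := hb.swap_last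
      rw [neg_neg] at hc
      exact hsl (isSl2_iff.2 ⟨_, _, hc⟩)
  rcases hP.exists_isNormalBasis hL with ⟨q, b, hb⟩ | ⟨p, q, b, h, hb⟩ <;>
    rcases hQ.exists_isNormalBasis hL with ⟨q', c, hc⟩ | ⟨p', q', c, h', hc⟩
  · obtain rfl := hb.eq_of_nonunimodular hc
    exact hb.exists_lieEquiv hc
  · exact (hb.not_unimodular hc).elim
  · exact (hc.not_unimodular hb).elim
  · have h1 := (hb.exists_killingForm_pos_iff h).symm.trans (hc.exists_killingForm_pos_iff h')
    have h2 := (hb.exists_killingForm_neg_iff h).symm.trans (hc.exists_killingForm_neg_iff h')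
    have h3 := (hb.killingForm_neg_definite_iff h).symm.trans (hc.killingForm_neg_definite_iff h')
    obtain ⟨rfl, rfl⟩ : p = p' ∧ q = q' := by
      rcases h with h | h | h | h | h | h <;> obtain ⟨rfl, rfl⟩ := h <;>
        first
        | exact absurd rfl (hnot hb).1
        | exact absurd rfl (hnot hb).2
        | skip
      all_goals
        rcases h' with h' | h' | h' | h' | h' | h' <;> obtain ⟨rfl, rfl⟩ := h' <;>
          first
          | exact absurd rfl (hnot hc).1
          | exact absurd rfl (hnot hc).2
          | exact ⟨rfl, rfl⟩
          | (norm_num at h1; done)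
          | (norm_num at h2; done)
          | norm_num at h3
    exact hb.exists_lieEquiv hc

theorem exists_two_of_isSl2 (hL : finrank ℝ L = 3) (hsl : IsSl2 L) :
    ∃ P Q : Submodule ℝ L, IsContactStructure P ∧ IsContactStructure Q ∧ ¬ Isomorphic P Q ∧
      ∀ R : Submodule ℝ L, IsContactStructure R → Isomorphic R P ∨ Isomorphic R Q := by
  obtain ⟨P, b, hb⟩ := isSl2_iff.1 hsl
  obtain ⟨Q, c, hc⟩ := hb.swap_last
  refine ⟨P, Q, hb.isContactStructure, hc.isContactStructure, ?_, fun R hR => ?_⟩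
  -- The Killing form is nonnegative on `P`, hence on every image of `P`, and negative at `c 1 ∈ Q`.
  · rintro ⟨φ, rfl⟩
    have hφ := hb.map φ
    have hmem : c 1 ∈ span ℝ {c 0, c 1} := subset_span (by simp)
    rw [hc.span_eq, ← hφ.span_eq, mem_span_basis_pair_iff] at hmem
    have h := (hφ.killingForm_self_of_unimodular (c 1)).symm.trans
      (hc.killingForm_self_of_unimodular (c 1))
    rw [hmem] at h
    simp only [Basis.repr_self, Finsupp.single_eq_same] at h
    simp at h
    nlinarith [sq_nonneg ((b.map φ.toLinearEquiv).repr (c 1) 0),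
      sq_nonneg ((b.map φ.toLinearEquiv).repr (c 1) 1)]
  · rcases hR.exists_isNormalBasis hL with ⟨q, e, he⟩ | ⟨p, q, e, h, he⟩
    · exact (he.not_unimodular hb).elim
    · have hpair : IsNormalPair 1 1 := by norm_num [IsNormalPair]
      obtain rfl := (he.exists_killingForm_pos_iff h).1
        ((hb.exists_killingForm_pos_iff hpair).2 rfl)
      have hq := (he.exists_killingForm_neg_iff h).1
        ((hb.exists_killingForm_neg_iff hpair).2 one_ne_zero)
      unfold IsNormalPair at h
      norm_num [hq] at h
      rcases h with rfl | rfl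
      · exact .inl (he.exists_lieEquiv hb)
      · exact .inr (he.exists_lieEquiv hc)

/-! ### Contact forms and existence -/

theorem wedgePow_one (α : Dual ℝ L) (v : Fin 3 → L) :
    wedgePow α 1 v = 2 * (α (v 0) * d α (v 1) (v 2) + α (v 1) * d α (v 2) (v 0)
      + α (v 2) * d α (v 0) (v 1)) := by
  have hskew : ∀ x y, d α x y = - d α y x := fun x y => by
    rw [d, d, ← lie_skew x y, map_neg]
  have huniv : (Finset.univ : Finset (Equiv.Perm (Fin 3))) = {1, Equiv.swap 0 1, Equiv.swap 0 2,
      Equiv.swap 1 2, Equiv.swap 0 1 * Equiv.swap 1 2, Equiv.swap 1 2 * Equiv.swap 0 1} := by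
    decide
  have h1 (σ : Equiv.Perm (Fin 3)) : ∏ i : Fin 1, d α (v (σ ⟨2 * i + 1, by omega⟩))
      (v (σ ⟨2 * i + 2, by omega⟩)) = d α (v (σ 1)) (v (σ 2)) := by
    rw [Fin.prod_univ_one]
    rfl
  unfold wedgePow
  change ∑ σ : Equiv.Perm (Fin 3), ((Equiv.Perm.sign σ : ℤ) : ℝ) * (α (v (σ 0)) *
    ∏ i : Fin 1, d α (v (σ ⟨2 * i + 1, by omega⟩)) (v (σ ⟨2 * i + 2, by omega⟩))) = _
  simp only [h1]
  rw [huniv]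
  repeat rw [Finset.sum_insert (by decide)]
  rw [Finset.sum_singleton]
  have e1 : (Equiv.swap 0 1 : Equiv.Perm (Fin 3)) 2 = 2 := by decide
  have e2 : (Equiv.swap 0 2 : Equiv.Perm (Fin 3)) 1 = 1 := by decide
  have e3 : (Equiv.swap 1 2 : Equiv.Perm (Fin 3)) 0 = 0 := by decide
  simp [e1, e2, e3]
  rw [hskew (v 2) (v 1), hskew (v 1) (v 0), hskew (v 0) (v 2)]
  ring

theorem isContactForm_iff (hL : finrank ℝ L = 3) {α : Dual ℝ L} :
    IsContactForm α ↔ ∃ x y z : L,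
      α x * α ⁅y, z⁆ + α y * α ⁅z, x⁆ + α z * α ⁅x, y⁆ ≠ 0 := by
  have key (v : Fin 3 → L) : wedgePow α 1 v = -2 * (α (v 0) * α ⁅v 1, v 2⁆
      + α (v 1) * α ⁅v 2, v 0⁆ + α (v 2) * α ⁅v 0, v 1⁆) := by
    rw [wedgePow_one]
    simp only [d]
    ring
  constructor
  · rintro ⟨n, hn, v, hv⟩
    obtain rfl : n = 1 := by omega
    exact ⟨v 0, v 1, v 2, fun h => hv ((key v).trans (by rw [h, mul_zero]))⟩
  · rintro ⟨x, y, z, h⟩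
    exact ⟨1, hL, ![x, y, z], fun h0 => h (by simpa using (key ![x, y, z]).symm.trans h0)⟩

theorem IsContactStructure.exists_isContactForm (hL : finrank ℝ L = 3) {P : Submodule ℝ L}
    (hP : IsContactStructure P) : ∃ α : Dual ℝ L, IsContactForm α := by
  obtain ⟨b, hb⟩ := hP.exists_isContactBasis hL
  refine ⟨b.coord 2, (isContactForm_iff hL).2 ⟨b 0, b 1, b 2, ?_⟩⟩
  simp [hb.lie_eq]

theorem IsExceptional.exists_lie_eq (h : IsExceptional L) :
    ∃ l : Dual ℝ L, ∀ x y : L, ⁅x, y⁆ = l y • x - l x • y := by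
  obtain ⟨b, h02, h12, h01⟩ := h
  refine ⟨b.coord 2, fun x y => ?_⟩
  simp only [Basis.coord_apply]
  generalize hx : b.repr x 2 = x₂
  generalize hy : b.repr y 2 = y₂
  rw [basis_expand b x, basis_expand b y, hx, hy]
  simp only [add_lie, lie_add, smul_lie, lie_smul, lie_self, ← lie_skew (b 1) (b 0),
    ← lie_skew (b 2) (b 0), ← lie_skew (b 2) (b 1), h01, h02, h12]
  module

theorem not_isContactForm_of_lie_eq (hL : finrank ℝ L = 3) {l : Dual ℝ L}
    (h : ∀ x y : L, ⁅x, y⁆ = l y • x - l x • y) (α : Dual ℝ L) : ¬ IsContactForm α := by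
  rw [isContactForm_iff hL]
  rintro ⟨x, y, z, hne⟩
  apply hne
  simp only [h, map_sub, map_smul, smul_eq_mul]
  ring

theorem isExceptional_of_lie_eq (hL : finrank ℝ L = 3) {l : Dual ℝ L}
    (h : ∀ x y : L, ⁅x, y⁆ = l y • x - l x • y) (hl : l ≠ 0) : IsExceptional L := by
  have : FiniteDimensional ℝ L := .of_finrank_pos (by omega)
  obtain ⟨z, hz⟩ : ∃ z, l z = 1 := LinearMap.surjective hl 1
  have hker : finrank ℝ (LinearMap.ker l) = 2 := by
    have := Module.Dual.finrank_ker_add_one_of_ne_zero hl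
    omega
  let e := finBasisOfFinrankEq ℝ (LinearMap.ker l) hker
  have hli : LinearIndependent ℝ ![(e 0 : L), (e 1 : L)] := by
    have := e.linearIndependent.map' (LinearMap.ker l).subtype (ker_subtype _)
    have heq : (LinearMap.ker l).subtype ∘ e = ![(e 0 : L), (e 1 : L)] := by
      ext i
      fin_cases i <;> rfl
    rwa [heq] at this
  obtain ⟨b, h0, h1, h2⟩ := exists_basis_of_notMem hL hli (e 0).2 (e 1).2
    (z := z) (by simp [hz])
  have hx : l (e 0) = 0 := (e 0).2
  have hy : l (e 1) = 0 := (e 1).2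
  exact ⟨b, by simp [h, h0, h2, hx, hz], by simp [h, h1, h2, hy, hz], by simp [h, h0, h1, hx, hy]⟩

/-- If every plane is a subalgebra, the bracket comes from a linear form. The Jacobi identity is not
needed: comparing `⁅x, y⁆`, `⁅x, z⁆` and `⁅x, y + z⁆` shows that the coefficient of `y` in `⁅x, y⁆`
depends on `x` alone. -/
theorem exists_lie_eq_of_forall_mem_span (hL : finrank ℝ L = 3)
    (h : ∀ u v : L, ⁅u, v⁆ ∈ span ℝ {u, v}) :
    ∃ l : Dual ℝ L, ∀ x y : L, ⁅x, y⁆ = l y • x - l x • y := by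
  have : FiniteDimensional ℝ L := .of_finrank_pos (by omega)
  let b : Basis (Fin 3) ℝ L := finBasisOfFinrankEq ℝ L hL
  obtain ⟨a₀, a₁, h01⟩ := mem_span_pair.1 (h (b 0) (b 1))
  obtain ⟨c₀, c₂, h02⟩ := mem_span_pair.1 (h (b 0) (b 2))
  obtain ⟨e₁, e₂, h12⟩ := mem_span_pair.1 (h (b 1) (b 2))
  obtain ⟨s, t, h0⟩ := mem_span_pair.1 (h (b 0) (b 1 + b 2))
  obtain ⟨s', t', h1⟩ := mem_span_pair.1 (h (b 1) (b 0 + b 2))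
  obtain ⟨s'', t'', h2⟩ := mem_span_pair.1 (h (b 2) (b 0 + b 1))
  rw [lie_add, ← h01, ← h02] at h0
  rw [lie_add, ← lie_skew (b 1) (b 0), ← h01, ← h12] at h1
  rw [lie_add, ← lie_skew (b 2) (b 0), ← lie_skew (b 2) (b 1), ← h02, ← h12] at h2
  obtain ⟨-, h01', h02'⟩ := basis_coeff_eq b (x := s) (y := t) (z := t)
    (x' := a₀ + c₀) (y' := a₁) (z' := c₂) (Eq.trans (by module) (h0.trans (by module)))
  obtain ⟨h10', -, h12'⟩ := basis_coeff_eq b (x := t') (y := s') (z := t')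
    (x' := -a₀) (y' := e₁ - a₁) (z' := e₂) (Eq.trans (by module) (h1.trans (by module)))
  obtain ⟨h20', h21', -⟩ := basis_coeff_eq b (x := t'') (y := t'') (z := s'')
    (x' := -c₀) (y' := -e₁) (z' := -c₂ - e₂) (Eq.trans (by module) (h2.trans (by module)))
  obtain rfl : c₂ = a₁ := by linarith
  obtain rfl : e₂ = -a₀ := by linarith
  obtain rfl : e₁ = c₀ := by linarith
  refine ⟨b.constr ℝ ![-c₂, a₀, e₁], fun x y => ?_⟩
  rw [basis_expand b x, basis_expand b y]
  simp only [add_lie, lie_add, smul_lie, lie_smul, lie_self, ← lie_skew (b 1) (b 0),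
    ← lie_skew (b 2) (b 0), ← lie_skew (b 2) (b 1), ← h01, ← h02, ← h12, map_add, map_smul,
    Basis.constr_basis, smul_eq_mul, Matrix.cons_val]
  module

theorem exists_isContactStructure (hL : finrank ℝ L = 3) (hab : ¬ IsLieAbelian L)
    (hexc : ¬ IsExceptional L) : ∃ P : Submodule ℝ L, IsContactStructure P := by
  by_contra hnone
  obtain ⟨l, hl⟩ := exists_lie_eq_of_forall_mem_span hL fun u v => by
    by_contra huv
    obtain ⟨b, hb, -⟩ := exists_isContactBasis hL huv
    exact hnone ⟨_, hb.isContactStructure⟩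
  by_cases hl0 : l = 0
  · exact hab ⟨fun x y => by simp [hl, hl0]⟩
  · exact hexc (isExceptional_of_lie_eq hL hl hl0)

theorem IsContactForm.not_isLieAbelian_and_not_isExceptional (hL : finrank ℝ L = 3) {α : Dual ℝ L}
    (hα : IsContactForm α) : ¬ IsLieAbelian L ∧ ¬ IsExceptional L := by
  refine ⟨fun hab => ?_, fun hexc => ?_⟩
  -- The bracket of an abelian Lie algebra comes from the form `0`.
  · exact not_isContactForm_of_lie_eq hL (l := 0) (fun x y => by simp [hab.trivial x y]) α hα
  · obtain ⟨l, hl⟩ := hexc.exists_lie_eq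
    exact not_isContactForm_of_lie_eq hL hl α hα

end

end ContactLie

open ContactLie in
theorem theorem2 (L : Type*) [LieRing L] [LieAlgebra ℝ L] (hL : Module.finrank ℝ L = 3) :
    ((∃ α : Module.Dual ℝ L, IsContactForm α) ↔ ¬ IsLieAbelian L ∧ ¬ IsExceptional L) ∧
    ((∃ P : Submodule ℝ L, IsContactStructure P) ↔ ¬ IsLieAbelian L ∧ ¬ IsExceptional L) ∧
    (¬ IsSl2 L → ∀ P Q : Submodule ℝ L,
      IsContactStructure P → IsContactStructure Q → Isomorphic P Q) ∧
    (IsSl2 L → ∃ P Q : Submodule ℝ L,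
      IsContactStructure P ∧ IsContactStructure Q ∧ ¬ Isomorphic P Q ∧
      ∀ R : Submodule ℝ L, IsContactStructure R → Isomorphic R P ∨ Isomorphic R Q) := by
  refine ⟨⟨?_, ?_⟩, ⟨?_, ?_⟩, ?_, exists_two_of_isSl2 hL⟩
  · rintro ⟨α, hα⟩
    exact hα.not_isLieAbelian_and_not_isExceptional hL
  · rintro ⟨hab, hexc⟩
    obtain ⟨P, hP⟩ := exists_isContactStructure hL hab hexc
    exact hP.exists_isContactForm hL
  · rintro ⟨P, hP⟩
    obtain ⟨α, hα⟩ := hP.exists_isContactForm hL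
    exact hα.not_isLieAbelian_and_not_isExceptional hL
  · rintro ⟨hab, hexc⟩
    exact exists_isContactStructure hL hab hexc
  · intro hsl P Q hP hQ
    exact isomorphic_of_not_isSl2 hL hsl hP hQ
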